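/- Let $d,p\ge 1$, let $A_1,\dots,A_p\in\mathbb{R}^{d\times d}$ be arbitrary fixed matrices, and let $(Y_t)_{t\ge -p+1}$ be an $\mathbb{R}^d$-valued process with $Y_t=\sum_{j=1}^p A_jY_{t-j}+\epsilon_t$ for $t\ge1$ (the initial values $Y_{-p+1},\dots,Y_0$ may be fixed or random). Put $\mathcal F_t=\sigma(Y_s:-p+1\le s\le t)$ and assume that the noise is conditionally sub-Gaussian: for all $t\ge1$, all unit vectors $\nu\in\mathbb{R}^d$ and all $\lambda\ge0$, almost surely $$\log\mathbb{E}\big[e^{\lambda\langle\nu,\epsilon_t\rangle}\,\big|\,\mathcal F_{t-1}\big]\le\lambda^2/2 .$$ Let $X_t=(Y_{t-1},\dots,Y_{t-p})\in\mathbb{R}^{dp}$, let $\mathbf X_t\in\mathbb{R}^{t\times dp}$ have rows $X_1,\dots,X_t$, and let $V_t=\mathbf X_t^\top\mathbf X_t$. Fix $i\in\{1,\dots,d\}$, let $\mathbf Y_t(i)=(Y_1(i),\dots,Y_t(i))^\top$, and let $\pi(i)\in\mathbb{R}^{dp}$ be the $i$-th row of the stacked matrix $\Pi=(A_1,\dots,A_p)$.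 For a symmetric positive semidefinite matrix $V$ and $\rho>0$, write $\gamma_{\min}(V),\gamma_{\max}(V)$ for its extreme eigenvalues, $\kappa(V)=\gamma_{\max}(V)/\gamma_{\min}(V)$, and $V\vee\rho I$ for the matrix with the same eigenvectors in which each eigenvalue $\gamma$ is replaced by $\max(\gamma,\rho)$. Let $N(r)$ be the least cardinality of a subset $K$ of the Euclidean unit sphere of $\mathbb{R}^{dp}$ such that every point of the sphere is within distance $r$ of $K$. Consider the row-wise least-squares estimates with shrinkage $$\hat\pi_t(i)=(V_t\vee\rho I)^{-1}\mathbf X_t^\top\mathbf Y_t(i),\qquad t\ge1,$$ which coincide with the ordinary least-squares estimates $V_t^{-1}\mathbf X_t^\top\mathbf Y_t(i)$ whenever $\gamma_{\min}(V_t)\ge\rho$. Let $\alpha>1$, $\beta>1$, $\rho>0$, $\epsilon\in(0,1)$, $\delta\in(0,1)$, and let $h:\{0,1,2,\dots\}\to(0,\infty)$ be nondecreasing with $\sum_{k\ge0}h(k)^{-1}\le1$. Define $$L_\rho(V)=\log h\!\left(\left\lfloor\log_\alpha\frac{\gamma_{\max}(V\vee\rho I)}{\rho}\right\rfloor\right)+\log\!\left(\frac1\delta\cdot\frac1{1-\beta^{-1}}\right)+\log\!\left(\beta\sqrt{\kappa(V\vee\rho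 I)}\;N\!\left(\frac{\epsilon}{\beta\sqrt{\kappa(V\vee\rho I)}}\right)\right).$$ Then, with probability at least $1-\delta$, simultaneously for all $t\ge1$, $$\big\|(V_t\vee\rho I)^{1/2}(\hat\pi_t(i)-\pi(i))\big\|\le\frac1{1-\epsilon}\sqrt{2\alpha L_\rho(V_t)}+\sqrt\rho\,\|\pi(i)\|\,\mathbf 1_{\{\gamma_{\min}(V_t)<\rho\}} .$$ In particular, on the same event, for every $t\ge1$ with $\gamma_{\min}(V_t)\ge\rho$, the ordinary least-squares estimate satisfies the bound without the second term. -/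

import Mathlib

open MeasureTheory ProbabilityTheory
open scoped Matrix NNReal ENNReal

noncomputable section

namespace VARModel

/-! ### Spectral quantities of symmetric matrices -/

section Spectral

variable {ι : Type*} [Fintype ι] [DecidableEq ι]

/-- Largest eigenvalue of a real symmetric matrix. -/
def gammaMax (V : Matrix ι ι ℝ) : ℝ := sSup (spectrum ℝ V)

/-- Smallest eigenvalue of a real symmetric matrix. -/
def gammaMin (V : Matrix ι ι ℝ) : ℝ := sInf (spectrum ℝ V)

/-- Condition number `κ(V) = γ_max(V) / γ_min(V)` (used only for positive definite `V`). -/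
def condNumber (V : Matrix ι ι ℝ) : ℝ := gammaMax V / gammaMin V

/-- `V ∨ ρ I`: every eigenvalue `γ` of the symmetric matrix `V` is replaced by `max γ ρ`,
the eigenvectors being kept. -/
def eigFloor (V : Matrix ι ι ℝ) (ρ : ℝ) : Matrix ι ι ℝ := cfc (fun x : ℝ => max x ρ) V

/-- The positive semidefinite square root `V^{1/2}` of a positive semidefinite matrix. -/
def matSqrt (V : Matrix ι ι ℝ) : Matrix ι ι ℝ := cfc Real.sqrt V

variable (ι) in
/-- The proper `r`-covering number, for `r > 0`, of the Euclidean unit sphere of `ℝ^ι`: the least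
cardinality of a set of points of the sphere whose closed `r`-balls cover the sphere.
It is finite because the sphere is compact. -/
def sphereCoveringNumber (r : ℝ) : ℕ :=
  (Metric.coveringNumber r.toNNReal (Metric.sphere (0 : EuclideanSpace ℝ ι) 1)).toNat

/-- The function `L_ρ` of the bound. As `h` is defined on the natural numbers,
it is evaluated at the integer part of `log_α (γ_max(V ∨ ρ I) / ρ) ≥ 0`. -/
def Lfun (α β ε δ ρ : ℝ) (h : ℕ → ℝ) (V : Matrix ι ι ℝ) : ℝ :=
  Real.log (h ⌊Real.logb α (gammaMax (eigFloor V ρ) / ρ)⌋₊)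
    + Real.log (1 / δ * (1 / (1 - β⁻¹)))
    + Real.log (β * √(condNumber (eigFloor V ρ))
        * (sphereCoveringNumber ι (ε / (β * √(condNumber (eigFloor V ρ)))) : ℝ))

end Spectral

/-! ### The vector autoregressive model -/

section Model

variable {Ω : Type*} {p d : ℕ}

/-- The σ-algebra `F_t = σ(Y_s : -p + 1 ≤ s ≤ t)`. -/
@[reducible] def past (p : ℕ) (Y : ℤ → Ω → EuclideanSpace ℝ (Fin d)) (t : ℤ) : MeasurableSpace Ω :=
  ⨆ s ∈ Set.Icc (-(p : ℤ) + 1) t, MeasurableSpace.comap (Y s) inferInstance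

/-- `(Y_t)_{t ≥ -p+1}` is a `p`-stage `ℝ^d`-valued autoregressive process with coefficient matrices
`A_1, …, A_p` (`A j` is `A_{j+1}`) and conditionally sub-Gaussian noise `(ξ_t)_{t ≥ 1}`.
The values of `Y` at times `< -p + 1` and of `ξ` at time `0` play no role. -/
structure IsVAR [MeasurableSpace Ω] (μ : Measure Ω)
    (A : Fin p → Matrix (Fin d) (Fin d) ℝ)
    (Y : ℤ → Ω → EuclideanSpace ℝ (Fin d)) (ξ : ℕ → Ω → EuclideanSpace ℝ (Fin d)) : Prop where
  measurable : ∀ t : ℤ, -(p : ℤ) + 1 ≤ t → Measurable (Y t)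
  recursion : ∀ t : ℕ, 1 ≤ t → ∀ ω,
    Y t ω = ∑ j : Fin p, Matrix.toEuclideanLin (A j) (Y ((t : ℤ) - ((j : ℤ) + 1)) ω) + ξ t ω
  /-- The conditional moment generating function is finite. (It is implied by the bound
  below when conditional expectations of nonnegative variables are allowed to be infinite.) -/
  integrable : ∀ t : ℕ, 1 ≤ t → ∀ ν : EuclideanSpace ℝ (Fin d), ‖ν‖ = 1 → ∀ l : ℝ, 0 ≤ l →
    Integrable (fun ω => Real.exp (l * inner ℝ ν (ξ t ω))) μ
  subGaussian : ∀ t : ℕ, 1 ≤ t → ∀ ν : EuclideanSpace ℝ (Fin d), ‖ν‖ = 1 → ∀ l : ℝ, 0 ≤ l →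
    ∀ᵐ ω ∂μ, Real.log
      ((μ[fun ω' => Real.exp (l * inner ℝ ν (ξ t ω')) | past p Y ((t : ℤ) - 1)]) ω) ≤ l ^ 2 / 2

/-- The `i`-th row `π(i) ∈ ℝ^{dp}` of the stacked matrix `Π = (A_1, …, A_p)`; coordinates of
`ℝ^{dp}` are indexed by pairs (lag, component). -/
def stackedRow (A : Fin p → Matrix (Fin d) (Fin d) ℝ) (i : Fin d) : Fin p × Fin d → ℝ :=
  fun q => A q.1 i q.2

/-- The `t × dp` matrix `𝐗_t` with rows `X_1, …, X_t`, where
`X_s = (Y_{s-1}, Y_{s-2}, …, Y_{s-p})`; row number `s` (counted from `0`) is `X_{s+1}`. -/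
def design (p : ℕ) (Y : ℤ → Ω → EuclideanSpace ℝ (Fin d)) (t : ℕ) (ω : Ω) :
    Matrix (Fin t) (Fin p × Fin d) ℝ :=
  Matrix.of fun s q => Y (((s : ℤ) + 1) - ((q.1 : ℤ) + 1)) ω q.2

/-- The vector `𝐘_t(i) = (Y_1(i), …, Y_t(i))`. -/
def response (Y : ℤ → Ω → EuclideanSpace ℝ (Fin d)) (t : ℕ) (ω : Ω) (i : Fin d) : Fin t → ℝ :=
  fun s => Y ((s : ℤ) + 1) ω i

/-- `V_t = 𝐗_tᵀ 𝐗_t`. -/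
def covProc (p : ℕ) (Y : ℤ → Ω → EuclideanSpace ℝ (Fin d)) (t : ℕ) (ω : Ω) :
    Matrix (Fin p × Fin d) (Fin p × Fin d) ℝ :=
  (design p Y t ω)ᵀ * design p Y t ω

/-- The row-wise least-squares estimate with shrinkage,
`(𝐗_tᵀ 𝐗_t ∨ ρ I)⁻¹ 𝐗_tᵀ 𝐘_t(i)`. -/
def lsEstimate (p : ℕ) (ρ : ℝ) (Y : ℤ → Ω → EuclideanSpace ℝ (Fin d)) (t : ℕ) (ω : Ω)
    (i : Fin d) : Fin p × Fin d → ℝ :=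
  (eigFloor (covProc p Y t ω) ρ)⁻¹ *ᵥ ((design p Y t ω)ᵀ *ᵥ response Y t ω i)

/-- The ordinary row-wise least-squares estimate `(𝐗_tᵀ 𝐗_t)⁻¹ 𝐗_tᵀ 𝐘_t(i)`, meaningful when
`𝐗_tᵀ 𝐗_t` is invertible. -/
def olsEstimate (p : ℕ) (Y : ℤ → Ω → EuclideanSpace ℝ (Fin d)) (t : ℕ) (ω : Ω)
    (i : Fin d) : Fin p × Fin d → ℝ :=
  (covProc p Y t ω)⁻¹ *ᵥ ((design p Y t ω)ᵀ *ᵥ response Y t ω i)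

/-- The Euclidean norm on `ℝ^ι`. -/
def eNorm {ι : Type*} [Fintype ι] (v : ι → ℝ) : ℝ := ‖(WithLp.toLp 2 v : EuclideanSpace ℝ ι)‖

end Model

end VARModel

end

/-! Write W = V_t ∨ ρI and let S be the sum of ξ_s(i) X_s over s ≤ t. The normal equations read
𝐗ᵀ𝐘(i) = V_t π(i) + S, so the weighted error splits into the noise W^{-1/2} S and the bias
W^{-1/2}(V_t − W)π(i). The bias is a scalar estimate on the spectrum and vanishes when W = V_t.

For a fixed direction ν, exp(l⟨ν,S⟩ − (l²/2) ν·V_tν) is a nonnegative supermartingale, and Ville's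
inequality controls it at all times at once. One value of l for each geometric range (ratio α) of
the clock max(ν·V_tν, ρ), with failure probability shared out by 1/h(k), gives the bound of
`measure_exists_stitched_lt_le`.

To reach all directions, put z = W⁻¹S. Then W^{-1/2}S = W^{1/2}z and ⟨ν,S⟩ = ⟨W^{1/2}ν, W^{1/2}z⟩.
If ν is within ε/√κ(W) of z/‖z‖, the images under W^{1/2} are almost parallel, and the norm is
recovered up to the factor 1 − ε (`eNorm_mulVec_le_of_near`). As κ(W) is random, nets of radius
ε/β^(j+1) are controlled for every j simultaneously, the j-th at total level δ(1 − β⁻¹)β^(-j), and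
the net with β^j ≤ √κ(W) ≤ β^(j+1) is used. The price of this choice is the last two terms of L_ρ.
-/

section Ville

/-! ### Ville's maximal inequality -/

variable {Ω : Type*} {m0 : MeasurableSpace Ω} {μ : Measure Ω}

/-- **Ville's inequality** for a nonnegative supermartingale with values in `ℝ≥0∞`. -/
theorem mul_measure_exists_le_le_lintegral {m : ℕ → MeasurableSpace Ω} (hm : ∀ t, m t ≤ m0)
    (hmono : Monotone m) {M : ℕ → Ω → ℝ≥0∞} (hM : ∀ t, Measurable[m t] (M t))
    (hstep : ∀ t s, MeasurableSet[m t] s → ∫⁻ ω in s, M (t + 1) ω ∂μ ≤ ∫⁻ ω in s, M t ω ∂μ)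
    (c : ℝ≥0∞) :
    c * μ {ω | ∃ t, c ≤ M t ω} ≤ ∫⁻ ω, M 0 ω ∂μ := by
  have hset : ∀ t, MeasurableSet[m t] {ω | c ≤ M t ω} := fun t =>
    hM t measurableSet_Ici
  let C : ℕ → Set Ω := fun t => ⋃ s ∈ Set.Iic t, {ω | c ≤ M s ω}
  have hCmeas : ∀ t, MeasurableSet[m t] (C t) := fun t =>
    @MeasurableSet.biUnion _ _ (m t) _ _ (Set.to_countable _)
      fun s hs => hmono (Set.mem_Iic.1 hs) _ (hset s)
  have hCmono : Monotone C := fun s t hst =>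
    Set.biUnion_subset_biUnion_left (Set.Iic_subset_Iic.2 hst)
  -- The left side is the mean of the process stopped on first reaching `c`, its value there being
  -- lowered to `c`. The supermartingale step is only applied on the complement of `C t`, which is
  -- known at time `t`.
  have key : ∀ t, ∫⁻ ω in (C t)ᶜ, M t ω ∂μ + c * μ (C t) ≤ ∫⁻ ω, M 0 ω ∂μ := by
    intro t
    induction t with
    | zero =>
      have h0 : C 0 = {ω | c ≤ M 0 ω} := by ext ω; simp [C]
      have hm0 := hm 0 _ (hCmeas 0)
      rw [← lintegral_add_compl (μ := μ) (M 0) hm0, add_comm]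
      refine add_le_add ?_ le_rfl
      rw [← setLIntegral_const]
      exact setLIntegral_mono' hm0 fun ω hω => by rw [h0] at hω; exact hω
    | succ t ih =>
      have hm0 := hm _ _ (hCmeas t)
      have hD := hm _ _ (hset (t + 1))
      have hC : C (t + 1) = C t ∪ ((C t)ᶜ ∩ {ω | c ≤ M (t + 1) ω}) := by
        ext ω
        simp only [C, Set.mem_iUnion, Set.mem_Iic, Set.mem_ofPred_eq, Set.mem_union, Set.mem_inter_iff,
          Set.mem_compl_iff]
        constructor
        · rintro ⟨s, hs, h⟩
          by_cases h' : ∃ s, ∃ (_ : s ≤ t), c ≤ M s ω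
          · exact Or.inl h'
          · refine Or.inr ⟨h', ?_⟩
            rcases Nat.le_succ_iff.1 hs with h1 | rfl
            · exact absurd ⟨s, h1, h⟩ h'
            · exact h
        · rintro (⟨s, hs, h⟩ | ⟨-, h⟩)
          · exact ⟨s, hs.trans (Nat.le_succ t), h⟩
          · exact ⟨t + 1, le_rfl, h⟩
      have hcompl : (C (t + 1))ᶜ = (C t)ᶜ \ {ω | c ≤ M (t + 1) ω} := by
        rw [hC]; ext ω; simp only [Set.mem_compl_iff, Set.mem_union, Set.mem_inter_iff, Set.mem_sdiff]
        tauto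
      calc ∫⁻ ω in (C (t + 1))ᶜ, M (t + 1) ω ∂μ + c * μ (C (t + 1))
          ≤ ∫⁻ ω in (C t)ᶜ \ {ω | c ≤ M (t + 1) ω}, M (t + 1) ω ∂μ
              + (c * μ (C t) + ∫⁻ ω in (C t)ᶜ ∩ {ω | c ≤ M (t + 1) ω}, M (t + 1) ω ∂μ) := by
            rw [hcompl, hC]
            gcongr
            refine (mul_le_mul_right (measure_union_le _ _) c).trans ?_
            rw [mul_add]
            gcongr
            rw [← setLIntegral_const]
            exact setLIntegral_mono' (hm0.compl.inter hD) fun ω hω => hω.2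
        _ = ∫⁻ ω in (C t)ᶜ, M (t + 1) ω ∂μ + c * μ (C t) := by
            rw [← lintegral_inter_add_sdiff (M (t + 1)) (C t)ᶜ hD]; ring
        _ ≤ ∫⁻ ω in (C t)ᶜ, M t ω ∂μ + c * μ (C t) := by
            exact add_le_add (hstep t _ (@MeasurableSet.compl _ _ (m t) (hCmeas t))) le_rfl
        _ ≤ _ := ih
  have hU : {ω | ∃ t, c ≤ M t ω} = ⋃ t, C t := by
    ext ω
    simp only [C, Set.mem_ofPred_eq, Set.mem_iUnion, Set.mem_Iic]
    exact ⟨fun ⟨t, h⟩ => ⟨t, t, le_rfl, h⟩, fun ⟨_, s, _, h⟩ => ⟨s, h⟩⟩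
  rw [hU, hCmono.measure_iUnion, ENNReal.mul_iSup]
  exact iSup_le fun t => le_add_self.trans (key t)

end Ville

/-! ### Conditional sub-Gaussian bounds with predictable coefficients -/

section SubGaussian

variable {Ω : Type*} {m m0 : MeasurableSpace Ω} {μ : Measure Ω} [IsProbabilityMeasure μ]

/-- For conditionally sub-Gaussian `ξ` and constant `l`,
the conditional expectation of `exp (l ξ - l² / 2)` is at most `1`. -/
theorem setLIntegral_exp_sub_le (hm : m ≤ m0) {ξ : Ω → ℝ} {l : ℝ}
    (hint : Integrable (fun ω => Real.exp (l * ξ ω)) μ)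
    (hsub : ∀ᵐ ω ∂μ, Real.log ((μ[fun ω' => Real.exp (l * ξ ω') | m]) ω) ≤ l ^ 2 / 2)
    {s : Set Ω} (hs : MeasurableSet[m] s) :
    ∫⁻ ω in s, ENNReal.ofReal (Real.exp (l * ξ ω - l ^ 2 / 2)) ∂μ ≤ μ s := by
  have hint' : Integrable (fun ω => Real.exp (l * ξ ω - l ^ 2 / 2)) μ := by
    simp only [sub_eq_add_neg, Real.exp_add]
    exact hint.mul_const _
  rw [← ofReal_integral_eq_lintegral_ofReal hint'.integrableOn
    (ae_of_all _ fun ω => (Real.exp_pos _).le)]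
  refine ENNReal.ofReal_le_of_le_toReal ?_
  have h1 : ∫ ω in s, Real.exp (l * ξ ω - l ^ 2 / 2) ∂μ
      = (∫ ω in s, (μ[fun ω' => Real.exp (l * ξ ω') | m]) ω ∂μ) * Real.exp (-(l ^ 2 / 2)) := by
    rw [setIntegral_condExp hm hint hs, ← integral_mul_const]
    simp only [sub_eq_add_neg, Real.exp_add]
  have h2 : ∫ ω in s, (μ[fun ω' => Real.exp (l * ξ ω') | m]) ω ∂μ
      ≤ ∫ _ in s, Real.exp (l ^ 2 / 2) ∂μ := by
    refine setIntegral_mono_ae integrable_condExp.integrableOn integrableOn_const ?_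
    filter_upwards [hsub] with ω hω
    -- `Real.log` carries no upper bound at nonpositive arguments, but there the required bound is
    -- trivial.
    rcases le_or_gt ((μ[fun ω' => Real.exp (l * ξ ω') | m]) ω) 0 with h0 | h0
    · exact h0.trans (Real.exp_pos _).le
    · exact (Real.log_le_iff_le_exp h0).1 hω
  rw [h1]
  refine (mul_le_mul_of_nonneg_right h2 (Real.exp_pos _).le).trans ?_
  rw [setIntegral_const, smul_eq_mul, mul_assoc, ← Real.exp_add, add_neg_cancel, Real.exp_zero,
    mul_one]
  rfl

/-- The constant `l` in `setLIntegral_exp_sub_le` can be replaced by an `m`-measurable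
coefficient, and the set by an `m`-measurable weight. -/
theorem lintegral_mul_exp_sub_le (hm : m ≤ m0) {ξ : Ω → ℝ} (hξ : Measurable[m0] ξ)
    (hint : ∀ l : ℝ, Integrable (fun ω => Real.exp (l * ξ ω)) μ)
    (hsub : ∀ l : ℝ,
      ∀ᵐ ω ∂μ, Real.log ((μ[fun ω' => Real.exp (l * ξ ω') | m]) ω) ≤ l ^ 2 / 2)
    {G : Ω → ℝ≥0∞} (hG : Measurable[m] G) {a : Ω → ℝ} (ha : Measurable[m] a) :
    ∫⁻ ω, G ω * ENNReal.ofReal (Real.exp (a ω * ξ ω - a ω ^ 2 / 2)) ∂μ ≤ ∫⁻ ω, G ω ∂μ := by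
  have hG0 : Measurable[m0] G := hG.mono hm le_rfl
  have hconst : ∀ (l : ℝ) (g : Ω → ℝ≥0∞), Measurable[m] g →
      ∫⁻ ω, g ω * ENNReal.ofReal (Real.exp (l * ξ ω - l ^ 2 / 2)) ∂μ ≤ ∫⁻ ω, g ω ∂μ := by
    intro l g hg
    have hf : Measurable[m0] fun ω => ENNReal.ofReal (Real.exp (l * ξ ω - l ^ 2 / 2)) := by
      fun_prop
    -- The bound on sets is an inequality of measures on `m`, so it integrates against any
    -- `m`-measurable weight.
    have hle : (μ.withDensity fun ω => ENNReal.ofReal (Real.exp (l * ξ ω - l ^ 2 / 2))).trim hm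
        ≤ μ.trim hm := by
      refine Measure.le_iff.2 fun s hs => ?_
      rw [trim_measurableSet_eq hm hs, trim_measurableSet_eq hm hs, withDensity_apply _ (hm s hs)]
      exact setLIntegral_exp_sub_le hm (hint l) (hsub l) hs
    calc ∫⁻ ω, g ω * ENNReal.ofReal (Real.exp (l * ξ ω - l ^ 2 / 2)) ∂μ
        = ∫⁻ ω, g ω ∂(μ.withDensity fun ω => ENNReal.ofReal (Real.exp (l * ξ ω - l ^ 2 / 2))) := by
          rw [lintegral_withDensity_eq_lintegral_mul μ hf (hg.mono hm le_rfl)]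
          simp only [Pi.mul_apply, mul_comm]
      _ ≤ ∫⁻ ω, g ω ∂μ := by
          rw [← lintegral_trim hm hg, ← lintegral_trim hm hg]
          exact lintegral_mono' hle le_rfl
  -- On each fibre of a simple coefficient the constant case applies, the fibre's indicator being
  -- absorbed into the weight.
  have hsimple : ∀ f : @SimpleFunc Ω m ℝ,
      ∫⁻ ω, G ω * ENNReal.ofReal (Real.exp (f ω * ξ ω - f ω ^ 2 / 2)) ∂μ ≤ ∫⁻ ω, G ω ∂μ := by
    intro f
    have hfib : ∀ y, MeasurableSet[m] (f ⁻¹' {y}) := fun y =>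
      @SimpleFunc.measurableSet_fiber _ _ m f y
    have hsplit : ∀ H : Ω → ℝ≥0∞, Measurable[m0] H →
        ∫⁻ ω, H ω ∂μ = ∑ y ∈ @SimpleFunc.range _ _ m f, ∫⁻ ω, (f ⁻¹' {y}).indicator H ω ∂μ := by
      intro H hH
      rw [← lintegral_finsetSum _ fun y _ => hH.indicator (hm _ (hfib y))]
      refine lintegral_congr fun ω => ?_
      rw [Finset.sum_eq_single (f ω)]
      · simp
      · intro y _ hy
        exact Set.indicator_of_notMem (fun h => hy (by simpa using h.symm)) _
      · intro h
        exact absurd (@SimpleFunc.mem_range_self _ _ m f ω) h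
    have hf0 : Measurable[m0] f := (@SimpleFunc.measurable _ _ m _ f).mono hm le_rfl
    rw [hsplit _ (by fun_prop), hsplit G hG0]
    refine Finset.sum_le_sum fun y _ => ?_
    refine le_trans (le_of_eq (lintegral_congr fun ω => ?_))
      (hconst y _ (hG.indicator (hfib y)))
    by_cases h : ω ∈ f ⁻¹' {y}
    · rw [Set.indicator_of_mem h, Set.indicator_of_mem h]
      rw [Set.mem_preimage, Set.mem_singleton_iff] at h
      rw [h]
    · rw [Set.indicator_of_notMem h, Set.indicator_of_notMem h, zero_mul]
  have has : StronglyMeasurable[m] a := ha.stronglyMeasurable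
  have hmeas : ∀ n, Measurable[m0] fun ω =>
      G ω * ENNReal.ofReal (Real.exp (has.approx n ω * ξ ω - has.approx n ω ^ 2 / 2)) := by
    intro n
    have : Measurable[m0] (has.approx n) := 
      (@SimpleFunc.measurable _ _ m _ (has.approx n)).mono hm le_rfl
    fun_prop
  -- Pointwise approximation by simple functions and Fatou's lemma; no domination is needed for an
  -- upper bound.
  calc ∫⁻ ω, G ω * ENNReal.ofReal (Real.exp (a ω * ξ ω - a ω ^ 2 / 2)) ∂μ
      ≤ ∫⁻ ω, Filter.liminf (fun n => G ω *
          ENNReal.ofReal (Real.exp (has.approx n ω * ξ ω - has.approx n ω ^ 2 / 2)))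
            Filter.atTop ∂μ := by
        refine lintegral_mono fun ω => le_of_eq (Filter.Tendsto.liminf_eq ?_).symm
        have hcont : Continuous fun x : ℝ => ENNReal.ofReal (Real.exp (x * ξ ω - x ^ 2 / 2)) :=
          ENNReal.continuous_ofReal.comp (by fun_prop)
        exact ENNReal.Tendsto.const_mul ((hcont.tendsto _).comp (has.tendsto_approx ω))
          (Or.inl (by simpa using Real.exp_pos _))
    _ ≤ Filter.liminf (fun n => ∫⁻ ω, G ω *
          ENNReal.ofReal (Real.exp (has.approx n ω * ξ ω - has.approx n ω ^ 2 / 2)) ∂μ)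
            Filter.atTop := lintegral_liminf_le hmeas
    _ ≤ Filter.liminf (fun _ : ℕ => ∫⁻ ω, G ω ∂μ) Filter.atTop :=
        Filter.liminf_le_liminf (Filter.Eventually.of_forall fun n => hsimple _)
    _ = _ := by simp

end SubGaussian

/-! ### Scalar self-normalized bounds -/

section SelfNormalized

variable {Ω : Type*} {m0 : MeasurableSpace Ω} {μ : Measure Ω} [IsProbabilityMeasure μ]
  {F : ℕ → MeasurableSpace Ω} {x e : ℕ → Ω → ℝ}

/-- The line-crossing inequality for a sum `∑ x_s e_s` with predictable `x` and
conditionally sub-Gaussian `e`. -/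
theorem measure_exists_line_crossing_le (hF : ∀ t, F t ≤ m0) (hmono : Monotone F)
    (hx : ∀ t, Measurable[F t] (x t)) (he : ∀ t, Measurable[F (t + 1)] (e t))
    (hint : ∀ t, ∀ l : ℝ, Integrable (fun ω => Real.exp (l * e t ω)) μ)
    (hsub : ∀ t, ∀ l : ℝ,
      ∀ᵐ ω ∂μ, Real.log ((μ[fun ω' => Real.exp (l * e t ω') | F t]) ω) ≤ l ^ 2 / 2)
    (l : ℝ) {q : ℝ} (hq : 0 < q) :
    μ {ω | ∃ t, Real.log q⁻¹ ≤ l * ∑ s ∈ Finset.range t, x s ω * e s ω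
        - l ^ 2 / 2 * ∑ s ∈ Finset.range t, x s ω ^ 2} ≤ ENNReal.ofReal q := by
  set L : ℕ → Ω → ℝ := fun t ω => l * ∑ s ∈ Finset.range t, x s ω * e s ω
        - l ^ 2 / 2 * ∑ s ∈ Finset.range t, x s ω ^ 2 with hL
  have hxm : ∀ {s t}, s ≤ t → Measurable[F t] (x s) := fun h => (hx _).mono (hmono h) le_rfl
  have hem : ∀ {s t}, s < t → Measurable[F t] (e s) := fun h => (he _).mono (hmono h) le_rfl
  have hLm : ∀ t, Measurable[F t] (L t) := by
    intro t
    refine Measurable.sub (Measurable.const_mul ?_ _) (Measurable.const_mul ?_ _)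
    · exact Finset.measurable_fun_sum _ fun s hs =>
        (hxm (Finset.mem_range.1 hs).le).mul (hem (Finset.mem_range.1 hs))
    · exact Finset.measurable_fun_sum _ fun s hs => (hxm (Finset.mem_range.1 hs).le).pow_const 2
  have hM : ∀ t, Measurable[F t] fun ω => ENNReal.ofReal (Real.exp (L t ω)) := fun t =>
    ENNReal.measurable_ofReal.comp (Real.measurable_exp.comp (hLm t))
  have hstep : ∀ t s, MeasurableSet[F t] s →
      ∫⁻ ω in s, ENNReal.ofReal (Real.exp (L (t + 1) ω)) ∂μ
        ≤ ∫⁻ ω in s, ENNReal.ofReal (Real.exp (L t ω)) ∂μ := by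
    intro t s hs
    rw [← lintegral_indicator (hF t s hs), ← lintegral_indicator (hF t s hs)]
    refine le_trans (le_of_eq (lintegral_congr fun ω => ?_))
      (lintegral_mul_exp_sub_le (hF t) ((he t).mono (hF (t + 1)) le_rfl) (hint t) (hsub t)
        ((hM t).indicator hs) ((hx t).const_mul l))
    by_cases h : ω ∈ s
    · rw [Set.indicator_of_mem h, Set.indicator_of_mem h,
        ← ENNReal.ofReal_mul (Real.exp_pos _).le, ← Real.exp_add]
      congr 2
      simp only [hL, Finset.sum_range_succ]
      ring
    · rw [Set.indicator_of_notMem h, Set.indicator_of_notMem h, zero_mul]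
  have hV := mul_measure_exists_le_le_lintegral (μ := μ) hF hmono hM hstep (ENNReal.ofReal q⁻¹)
  have h0 : ∫⁻ ω, ENNReal.ofReal (Real.exp (L 0 ω)) ∂μ = 1 := by simp [hL]
  have hset : {ω | ∃ t, Real.log q⁻¹ ≤ L t ω}
      = {ω | ∃ t, ENNReal.ofReal q⁻¹ ≤ ENNReal.ofReal (Real.exp (L t ω))} := by
    ext ω
    simp only [Set.mem_ofPred_eq]
    refine exists_congr fun t => ?_
    rw [ENNReal.ofReal_le_ofReal_iff (Real.exp_pos _).le, Real.log_le_iff_le_exp (inv_pos.2 hq)]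
  rw [hset]
  rw [h0, ENNReal.ofReal_inv_of_pos hq] at hV
  have := (ENNReal.inv_mul_le_iff (by simpa using hq) ENNReal.ofReal_ne_top).1 hV
  simpa [ENNReal.ofReal_inv_of_pos hq] using this

/-- The stitched self-normalized bound for a sum `∑ x_s e_s` with predictable `x` and conditionally
sub-Gaussian `e`. -/
theorem measure_exists_stitched_lt_le (hF : ∀ t, F t ≤ m0) (hmono : Monotone F)
    (hx : ∀ t, Measurable[F t] (x t)) (he : ∀ t, Measurable[F (t + 1)] (e t))
    (hint : ∀ t, ∀ l : ℝ, Integrable (fun ω => Real.exp (l * e t ω)) μ)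
    (hsub : ∀ t, ∀ l : ℝ,
      ∀ᵐ ω ∂μ, Real.log ((μ[fun ω' => Real.exp (l * e t ω') | F t]) ω) ≤ l ^ 2 / 2)
    {α ρ q : ℝ} (hα : 1 < α) (hρ : 0 < ρ) (hq : 0 < q) (hq1 : q ≤ 1)
    {h : ℕ → ℝ} (hh : ∀ k, 1 ≤ h k) (hsum : Summable fun k => (h k)⁻¹)
    (hle : ∑' k, (h k)⁻¹ ≤ 1) :
    μ {ω | ∃ t, √(2 * α * (Real.log (h ⌊Real.logb α
          (max (∑ s ∈ Finset.range t, x s ω ^ 2) ρ / ρ)⌋₊) + Real.log q⁻¹))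
        * √(max (∑ s ∈ Finset.range t, x s ω ^ 2) ρ) < ∑ s ∈ Finset.range t, x s ω * e s ω}
      ≤ ENNReal.ofReal q := by
  have hα0 : 0 < α := one_pos.trans hα
  have hhpos : ∀ k, 0 < h k := fun k => one_pos.trans_le (hh k)
  set y : ℕ → ℝ := fun k => Real.log (h k) + Real.log q⁻¹ with hy
  have hy0 : ∀ k, 0 ≤ y k := fun k =>
    add_nonneg (Real.log_nonneg (hh k)) (Real.log_nonneg ((one_le_inv₀ hq).2 hq1))
  have hyq : ∀ k, Real.log (q / h k)⁻¹ = y k := fun k => by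
    rw [inv_div, div_eq_mul_inv, Real.log_mul (hhpos k).ne' (inv_pos.2 hq).ne']
  -- This is the optimal slope at the right end P = α^(k+1)ρ of the k-th range of the clock: with S
  -- = √(2 y P) and U = P, the line l S − l² U / 2 equals y.
  set l : ℕ → ℝ := fun k => √(2 * y k / (α ^ (k + 1) * ρ)) with hl
  have hsubset : {ω | ∃ t, √(2 * α * y ⌊Real.logb α
          (max (∑ s ∈ Finset.range t, x s ω ^ 2) ρ / ρ)⌋₊)
        * √(max (∑ s ∈ Finset.range t, x s ω ^ 2) ρ) < ∑ s ∈ Finset.range t, x s ω * e s ω}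
      ⊆ ⋃ k, {ω | ∃ t, Real.log (q / h k)⁻¹ ≤ l k * ∑ s ∈ Finset.range t, x s ω * e s ω
        - l k ^ 2 / 2 * ∑ s ∈ Finset.range t, x s ω ^ 2} := by
    rintro ω ⟨t, ht⟩
    set U := ∑ s ∈ Finset.range t, x s ω ^ 2
    set S := ∑ s ∈ Finset.range t, x s ω * e s ω
    set U' := max U ρ
    set k := ⌊Real.logb α (U' / ρ)⌋₊ with hk
    refine Set.mem_iUnion.2 ⟨k, t, ?_⟩
    rw [hyq]
    have hU'ρ : 1 ≤ U' / ρ := (one_le_div hρ).2 (le_max_right _ _)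
    have hU'0 : 0 < U' / ρ := one_pos.trans_le hU'ρ
    have hlog0 : 0 ≤ Real.logb α (U' / ρ) := Real.logb_nonneg hα hU'ρ
    have hlow : α ^ k ≤ U' / ρ := by
      rw [← Real.rpow_natCast, ← Real.le_logb_iff_rpow_le hα hU'0]
      exact Nat.floor_le hlog0
    have hup : U' / ρ ≤ α ^ (k + 1) := by
      rw [← Real.rpow_natCast, ← Real.logb_le_iff_le_rpow hα hU'0]
      push_cast
      exact (Nat.lt_floor_add_one _).le
    have hlow' : α ^ k * ρ ≤ U' := (le_div_iff₀ hρ).1 hlow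
    have hup' : U' ≤ α ^ (k + 1) * ρ := (div_le_iff₀ hρ).1 hup
    have hpos : 0 < α ^ (k + 1) * ρ := by positivity
    set P := α ^ (k + 1) * ρ with hP
    have hl2 : l k ^ 2 = 2 * y k / P := Real.sq_sqrt (by have := hy0 k; positivity)
    have hlS : 2 * y k ≤ l k * S := by
      have h1 : √(2 * y k * P) ≤ S := by
        refine le_trans ?_ ht.le
        rw [← Real.sqrt_mul (by have := hy0 k; positivity)]
        refine Real.sqrt_le_sqrt ?_
        -- The factor α in the final bound pays for replacing the clock by the right end of its
        -- range.
        have h2 : P ≤ α * U' := by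
          rw [hP, pow_succ]
          calc α ^ k * α * ρ = α * (α ^ k * ρ) := by ring
            _ ≤ _ := by gcongr
        nlinarith [hy0 k]
      calc 2 * y k = l k * √(2 * y k * P) := by
            rw [hl, ← Real.sqrt_mul (by have := hy0 k; positivity)]
            rw [show 2 * y k / P * (2 * y k * P) = (2 * y k) ^ 2 by field_simp,
              Real.sqrt_sq (by have := hy0 k; positivity)]
        _ ≤ _ := mul_le_mul_of_nonneg_left h1 (Real.sqrt_nonneg _)
    have hlU : l k ^ 2 / 2 * U ≤ y k := by
      rw [hl2]
      calc 2 * y k / P / 2 * U = y k * (U / P) := by ring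
        _ ≤ y k * 1 := by
          refine mul_le_mul_of_nonneg_left ?_ (hy0 k)
          exact (div_le_one hpos).2 ((le_max_left _ _).trans hup')
        _ = y k := mul_one _
    linarith
  refine (measure_mono hsubset).trans ((measure_iUnion_le _).trans ?_)
  calc ∑' k, μ {ω | ∃ t, Real.log (q / h k)⁻¹ ≤ l k * ∑ s ∈ Finset.range t, x s ω * e s ω
        - l k ^ 2 / 2 * ∑ s ∈ Finset.range t, x s ω ^ 2}
      ≤ ∑' k, ENNReal.ofReal (q / h k) := ENNReal.tsum_le_tsum fun k =>
        measure_exists_line_crossing_le hF hmono hx he hint hsub (l k) (div_pos hq (hhpos k))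
    _ = ENNReal.ofReal (∑' k, q / h k) := by
        simp only [div_eq_mul_inv]
        exact (ENNReal.ofReal_tsum_of_nonneg
          (fun k => mul_nonneg hq.le (inv_nonneg.2 (hhpos k).le)) (hsum.mul_left q)).symm
    _ ≤ ENNReal.ofReal q := by
        refine ENNReal.ofReal_le_ofReal ?_
        simp only [div_eq_mul_inv, tsum_mul_left]
        exact mul_le_of_le_one_right hq.le hle

end SelfNormalized

namespace VARModel

/-! ### Euclidean geometry of nearby directions -/

section ENorm

variable {ι : Type*} [Fintype ι]

theorem eNorm_nonneg (v : ι → ℝ) : 0 ≤ eNorm v := norm_nonneg _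

theorem eNorm_sq (v : ι → ℝ) : eNorm v ^ 2 = v ⬝ᵥ v := by
  rw [eNorm, EuclideanSpace.real_norm_sq_eq, dotProduct]
  exact Finset.sum_congr rfl fun i _ => sq (v i)

theorem eNorm_add_le (v w : ι → ℝ) : eNorm (v + w) ≤ eNorm v + eNorm w := by
  rw [eNorm, WithLp.toLp_add]
  exact norm_add_le _ _

theorem eNorm_smul (c : ℝ) (v : ι → ℝ) : eNorm (c • v) = |c| * eNorm v := by
  rw [eNorm, WithLp.toLp_smul, norm_smul, Real.norm_eq_abs, eNorm]

theorem dotProduct_self_mulVec_of_isSymm {R : Matrix ι ι ℝ} (hR : R.IsSymm) (v w : ι → ℝ) :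
    (R *ᵥ v) ⬝ᵥ (R *ᵥ w) = v ⬝ᵥ ((R * R) *ᵥ w) := by
  rw [← Matrix.mulVec_mulVec, Matrix.dotProduct_mulVec v, ← Matrix.mulVec_transpose, hR.eq]

/-- If `ν` is within `r` of the direction `u` of `z`, where `r` is small relative to the condition
number of `R * R`, then a bound on the component of `R * R * z` along `ν` bounds `‖R z‖`. -/
theorem eNorm_mulVec_le_of_near {R : Matrix ι ι ℝ} (hR : R.IsSymm) {a b r ε B c : ℝ} (ha : 0 < a)
    (hlow : ∀ x, a * (x ⬝ᵥ x) ≤ x ⬝ᵥ ((R * R) *ᵥ x))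
    (hup : ∀ x, x ⬝ᵥ ((R * R) *ᵥ x) ≤ b * (x ⬝ᵥ x)) (hb : 0 ≤ b)
    (hε : 0 ≤ ε) (hε1 : ε ≤ 1) (hr : r ^ 2 * b ≤ ε ^ 2 * a)
    {u ν : ι → ℝ} (hu : u ⬝ᵥ u = 1) (hν : ν ⬝ᵥ ν = 1)
    (hνu : (ν - u) ⬝ᵥ (ν - u) ≤ r ^ 2) (hc : 0 ≤ c)
    (hB : ν ⬝ᵥ ((R * R) *ᵥ (c • u)) ≤ B * eNorm (R *ᵥ ν)) :
    (1 - ε) * eNorm (R *ᵥ (c • u)) ≤ B := by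
  have hS : ∀ x, eNorm (R *ᵥ x) ^ 2 = x ⬝ᵥ ((R * R) *ᵥ x) := fun x => by
    rw [eNorm_sq, dotProduct_self_mulVec_of_isSymm hR]
  have hu2 : a ≤ eNorm (R *ᵥ u) ^ 2 := by have := hlow u; rw [hu, mul_one] at this; rwa [hS]
  have hν2 : a ≤ eNorm (R *ᵥ ν) ^ 2 := by have := hlow ν; rw [hν, mul_one] at this; rwa [hS]
  have hu0 := eNorm_nonneg (R *ᵥ u)
  have hν0 := eNorm_nonneg (R *ᵥ ν)
  have hνpos : 0 < eNorm (R *ᵥ ν) := by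
    refine lt_of_le_of_ne hν0 fun h => ?_
    rw [← h] at hν2
    norm_num at hν2
    linarith
  have hprod : a ≤ eNorm (R *ᵥ u) * eNorm (R *ᵥ ν) := by
    refine abs_le_of_sq_le_sq' ?_ (mul_nonneg hu0 hν0) |>.2
    rw [mul_pow, sq a]
    exact mul_le_mul hu2 hν2 ha.le (sq_nonneg _)
  have hdiff : eNorm (R *ᵥ (ν - u)) ^ 2 ≤ ε ^ 2 * a := by
    rw [hS]
    refine (hup _).trans (le_trans ?_ hr)
    rw [mul_comm]
    exact mul_le_mul_of_nonneg_right hνu hb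
  have hexp : eNorm (R *ᵥ (ν - u)) ^ 2
      = eNorm (R *ᵥ ν) ^ 2 + eNorm (R *ᵥ u) ^ 2 - 2 * ((R *ᵥ ν) ⬝ᵥ (R *ᵥ u)) := by
    rw [eNorm_sq, eNorm_sq, eNorm_sq, Matrix.mulVec_sub, sub_dotProduct, dotProduct_sub,
      dotProduct_sub, dotProduct_comm (R *ᵥ u) (R *ᵥ ν)]
    ring
  -- By polarization and AM-GM, 2⟨Rν,Ru⟩ ≥ 2‖Rν‖‖Ru‖ − ε²a, and a ≤ ‖Rν‖‖Ru‖. Hence the cosine is at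
  -- least 1 − ε²/2 ≥ 1 − ε.
  have hang : (1 - ε) * (eNorm (R *ᵥ u) * eNorm (R *ᵥ ν)) ≤ (R *ᵥ ν) ⬝ᵥ (R *ᵥ u) := by
    have h1 : ε ^ 2 * a ≤ ε ^ 2 * (eNorm (R *ᵥ u) * eNorm (R *ᵥ ν)) := by gcongr
    have h2 : ε ^ 2 * (eNorm (R *ᵥ u) * eNorm (R *ᵥ ν))
        ≤ 2 * ε * (eNorm (R *ᵥ u) * eNorm (R *ᵥ ν)) :=
      mul_le_mul_of_nonneg_right (by nlinarith) (mul_nonneg hu0 hν0)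
    nlinarith [sq_nonneg (eNorm (R *ᵥ u) - eNorm (R *ᵥ ν))]
  have hdot : ν ⬝ᵥ ((R * R) *ᵥ (c • u)) = c * ((R *ᵥ ν) ⬝ᵥ (R *ᵥ u)) := by
    rw [← dotProduct_self_mulVec_of_isSymm hR, Matrix.mulVec_smul, dotProduct_smul, smul_eq_mul]
  rw [hdot] at hB
  rw [Matrix.mulVec_smul, eNorm_smul, abs_of_nonneg hc]
  refine le_of_mul_le_mul_right ?_ hνpos
  calc (1 - ε) * (c * eNorm (R *ᵥ u)) * eNorm (R *ᵥ ν)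
      = c * ((1 - ε) * (eNorm (R *ᵥ u) * eNorm (R *ᵥ ν))) := by ring
    _ ≤ c * ((R *ᵥ ν) ⬝ᵥ (R *ᵥ u)) := mul_le_mul_of_nonneg_left hang hc
    _ ≤ _ := hB

end ENorm

/-! ### Spectral calculus for V ∨ ρI and the bias term -/

section Spectrum

variable {ι : Type*} [Fintype ι] [DecidableEq ι] {V : Matrix ι ι ℝ}

-- Reduces the quadratic form inequalities below to scalar inequalities on the spectrum. No symmetry
-- of `V` is required, since `cfc` is zero on both sides otherwise.
open scoped MatrixOrder in
theorem dotProduct_cfc_mulVec_mono {f g : ℝ → ℝ} (hf : Continuous f) (hg : Continuous g)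
    (hfg : ∀ x ∈ spectrum ℝ V, f x ≤ g x) (v : ι → ℝ) :
    v ⬝ᵥ (cfc f V *ᵥ v) ≤ v ⬝ᵥ (cfc g V *ᵥ v) := by
  have h := cfc_mono (a := V) hfg hf.continuousOn hg.continuousOn
  rw [Matrix.le_iff] at h
  have := h.dotProduct_mulVec_nonneg v
  rw [Matrix.sub_mulVec, dotProduct_sub, star_trivial] at this
  linarith

theorem isSymm_cfc (f : ℝ → ℝ) (V : Matrix ι ι ℝ) : (cfc f V).IsSymm := by
  have h : IsSelfAdjoint (cfc f V) := cfc_predicate f V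
  have h2 := h.star_eq
  rwa [Matrix.star_eq_conjTranspose, Matrix.conjTranspose_eq_transpose_of_trivial] at h2

theorem finite_spectrum_real (V : Matrix ι ι ℝ) : (spectrum ℝ V).Finite :=
  Matrix.finite_real_spectrum

theorem spectrum_nonempty_of_isHermitian [Nonempty ι] (hV : V.IsHermitian) :
    (spectrum ℝ V).Nonempty := by
  rw [hV.spectrum_real_eq_range_eigenvalues]
  exact Set.range_nonempty _

theorem dotProduct_const_cfc (hV : V.IsHermitian) (c : ℝ) (v : ι → ℝ) :
    v ⬝ᵥ (cfc (fun _ : ℝ => c) V *ᵥ v) = c * (v ⬝ᵥ v) := by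
  rw [cfc_const c V hV.isSelfAdjoint, Algebra.algebraMap_eq_smul_one, Matrix.smul_mulVec,
    Matrix.one_mulVec, dotProduct_smul, smul_eq_mul]

theorem dotProduct_mulVec_le_gammaMax (hV : V.IsHermitian) (v : ι → ℝ) :
    v ⬝ᵥ (V *ᵥ v) ≤ gammaMax V * (v ⬝ᵥ v) := by
  have h := dotProduct_cfc_mulVec_mono (V := V) (f := fun x => x) (g := fun _ => gammaMax V)
    continuous_id continuous_const
    (fun x hx => le_csSup (finite_spectrum_real V).bddAbove hx) v
  rwa [cfc_id' ℝ V hV.isSelfAdjoint, dotProduct_const_cfc hV] at h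

theorem gammaMin_le_dotProduct_mulVec (hV : V.IsHermitian) (v : ι → ℝ) :
    gammaMin V * (v ⬝ᵥ v) ≤ v ⬝ᵥ (V *ᵥ v) := by
  have h := dotProduct_cfc_mulVec_mono (V := V) (g := fun x => x) (f := fun _ => gammaMin V)
    continuous_const continuous_id
    (fun x hx => csInf_le (finite_spectrum_real V).bddBelow hx) v
  rwa [cfc_id' ℝ V hV.isSelfAdjoint, dotProduct_const_cfc hV] at h

theorem gammaMin_le_gammaMax [Nonempty ι] (hV : V.IsHermitian) : gammaMin V ≤ gammaMax V :=
  csInf_le_csSup (spectrum_nonempty_of_isHermitian hV) (finite_spectrum_real V).bddBelow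
    (finite_spectrum_real V).bddAbove

variable {ρ : ℝ}

theorem isHermitian_eigFloor (V : Matrix ι ι ℝ) (ρ : ℝ) : (eigFloor V ρ).IsHermitian := by
  rw [Matrix.IsHermitian, Matrix.conjTranspose_eq_transpose_of_trivial]
  exact isSymm_cfc _ V

theorem le_gammaMin_eigFloor [Nonempty ι] (hV : V.IsHermitian) : ρ ≤ gammaMin (eigFloor V ρ) := by
  refine le_csInf (spectrum_nonempty_of_isHermitian (isHermitian_eigFloor V ρ)) ?_
  rw [eigFloor, cfc_map_spectrum (fun x : ℝ => max x ρ) V hV.isSelfAdjoint]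
  rintro _ ⟨x, -, rfl⟩
  exact le_max_right _ _

theorem eigFloor_eq_self (hV : V.IsHermitian) (h : ρ ≤ gammaMin V) : eigFloor V ρ = V := by
  rw [eigFloor, cfc_congr (g := fun x => x), cfc_id' ℝ V hV.isSelfAdjoint]
  intro x hx
  exact max_eq_left (h.trans (csInf_le (finite_spectrum_real V).bddBelow hx))

theorem dotProduct_mulVec_le_eigFloor (hV : V.IsHermitian) (ρ : ℝ) (v : ι → ℝ) :
    v ⬝ᵥ (V *ᵥ v) ≤ v ⬝ᵥ (eigFloor V ρ *ᵥ v) := by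
  have h := dotProduct_cfc_mulVec_mono (V := V) (f := fun x => x) (g := fun x => max x ρ)
    continuous_id (by fun_prop) (fun x _ => le_max_left _ _) v
  rwa [cfc_id' ℝ V hV.isSelfAdjoint] at h

theorem one_le_condNumber_eigFloor [Nonempty ι] (hV : V.IsHermitian) (hρ : 0 < ρ) :
    1 ≤ condNumber (eigFloor V ρ) :=
  (one_le_div (hρ.trans_le (le_gammaMin_eigFloor hV))).2
    (gammaMin_le_gammaMax (isHermitian_eigFloor V ρ))

theorem matSqrt_eigFloor (hV : V.IsHermitian) (ρ : ℝ) :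
    matSqrt (eigFloor V ρ) = cfc (fun x : ℝ => √(max x ρ)) V := by
  rw [matSqrt, eigFloor, ← cfc_comp' Real.sqrt (fun x : ℝ => max x ρ) V
    Real.continuous_sqrt.continuousOn (by fun_prop) hV.isSelfAdjoint]

theorem matSqrt_mul_matSqrt_eigFloor (hV : V.IsHermitian) (hρ : 0 < ρ) :
    matSqrt (eigFloor V ρ) * matSqrt (eigFloor V ρ) = eigFloor V ρ := by
  rw [matSqrt_eigFloor hV, ← cfc_mul _ _ V (by fun_prop) (by fun_prop), eigFloor]
  refine cfc_congr fun x _ => ?_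
  exact Real.mul_self_sqrt (hρ.le.trans (le_max_right _ _))

theorem continuous_max_inv (hρ : 0 < ρ) : Continuous fun x : ℝ => (max x ρ)⁻¹ :=
  (by fun_prop : Continuous fun x : ℝ => max x ρ).inv₀
    fun x => (hρ.trans_le (le_max_right x ρ)).ne'

theorem isUnit_det_eigFloor (hV : V.IsHermitian) (hρ : 0 < ρ) : IsUnit (eigFloor V ρ).det := by
  refine Matrix.isUnit_det_of_right_inverse (B := cfc (fun x : ℝ => (max x ρ)⁻¹) V) ?_
  rw [eigFloor, ← cfc_mul _ _ V (by fun_prop) (continuous_max_inv hρ).continuousOn,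
    ← cfc_one ℝ V hV.isSelfAdjoint]
  refine cfc_congr fun x _ => ?_
  exact mul_inv_cancel₀ (hρ.trans_le (le_max_right x ρ)).ne'

theorem eigFloor_mulVec_inv_mulVec (hV : V.IsHermitian) (hρ : 0 < ρ) (v : ι → ℝ) :
    eigFloor V ρ *ᵥ ((eigFloor V ρ)⁻¹ *ᵥ v) = v := by
  rw [Matrix.mulVec_mulVec, Matrix.mul_nonsing_inv _ (isUnit_det_eigFloor hV hρ),
    Matrix.one_mulVec]

/-- The bias caused by replacing `V` by `V ∨ ρ I`. -/
theorem eNorm_matSqrt_mulVec_bias_le (hV : V.PosSemidef) (hρ : 0 < ρ) (w : ι → ℝ) :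
    eNorm (matSqrt (eigFloor V ρ) *ᵥ ((eigFloor V ρ)⁻¹ *ᵥ ((V - eigFloor V ρ) *ᵥ w)))
      ≤ √ρ * eNorm w := by
  have hsa := hV.1.isSelfAdjoint
  have hci := continuous_max_inv hρ
  have hpos : ∀ x : ℝ, 0 < max x ρ := fun x => hρ.trans_le (le_max_right x ρ)
  -- Factoring `eigFloor V ρ` out on the left lets its inverse cancel, leaving a single function of
  -- `V`.
  have hdiff : V - eigFloor V ρ
      = eigFloor V ρ * cfc (fun x : ℝ => (x - max x ρ) * (max x ρ)⁻¹) V := by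
    have h1 : V - eigFloor V ρ = cfc (fun x : ℝ => x - max x ρ) V := by
      rw [cfc_sub (fun x : ℝ => x) (fun x => max x ρ) V (by fun_prop) (by fun_prop),
        cfc_id' ℝ V hsa, eigFloor]
    rw [h1, eigFloor, ← cfc_mul _ _ V (by fun_prop) (by fun_prop)]
    refine cfc_congr fun x _ => ?_
    have := (hpos x).ne'
    field_simp
  have hk : Continuous fun x : ℝ => √(max x ρ) * ((x - max x ρ) * (max x ρ)⁻¹) := by fun_prop
  rw [Matrix.mulVec_mulVec, Matrix.mulVec_mulVec, hdiff, Matrix.mul_assoc (matSqrt _),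
    ← Matrix.mul_assoc (eigFloor V ρ)⁻¹,
    Matrix.nonsing_inv_mul _ (isUnit_det_eigFloor hV.1 hρ), Matrix.one_mul,
    matSqrt_eigFloor hV.1, ← cfc_mul _ _ V (by fun_prop) (by fun_prop)]
  refine abs_le_of_sq_le_sq' ?_ (mul_nonneg (Real.sqrt_nonneg _) (eNorm_nonneg _)) |>.2
  rw [eNorm_sq, dotProduct_self_mulVec_of_isSymm (isSymm_cfc _ V), mul_pow, Real.sq_sqrt hρ.le,
    eNorm_sq, ← cfc_mul _ _ V hk.continuousOn hk.continuousOn, ← dotProduct_const_cfc hV.1]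
  refine dotProduct_cfc_mulVec_mono (hk.mul hk) continuous_const (fun x hx => ?_) w
  -- Positivity of `V` is essential: (x − ρ)²/ρ ≤ ρ holds for 0 ≤ x ≤ ρ but fails for negative x.
  have hx0 : 0 ≤ x := by
    rw [hV.1.spectrum_real_eq_range_eigenvalues] at hx
    obtain ⟨i, rfl⟩ := hx
    exact hV.eigenvalues_nonneg i
  have hxm := hpos x
  have hsq := Real.mul_self_sqrt hxm.le
  calc √(max x ρ) * ((x - max x ρ) * (max x ρ)⁻¹) * (√(max x ρ) * ((x - max x ρ) * (max x ρ)⁻¹))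
      = (√(max x ρ) * √(max x ρ)) * ((x - max x ρ) * (max x ρ)⁻¹) ^ 2 := by ring
    _ = (x - max x ρ) ^ 2 / max x ρ := by rw [hsq]; field_simp
    _ ≤ ρ := by
      rw [div_le_iff₀ hxm]
      rcases le_total x ρ with h | h
      · rw [max_eq_right h]; nlinarith
      · rw [max_eq_left h]; nlinarith

/-- Bias–noise decomposition of the error of the estimate with shrinkage. -/
theorem eNorm_matSqrt_mulVec_error_le (hV : V.PosSemidef) (hρ : 0 < ρ) (S w : ι → ℝ) :
    eNorm (matSqrt (eigFloor V ρ) *ᵥ ((eigFloor V ρ)⁻¹ *ᵥ (V *ᵥ w + S) - w))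
      ≤ eNorm (matSqrt (eigFloor V ρ) *ᵥ ((eigFloor V ρ)⁻¹ *ᵥ S))
        + √ρ * eNorm w * (if gammaMin V < ρ then 1 else 0) := by
  have hw : (eigFloor V ρ)⁻¹ *ᵥ (eigFloor V ρ *ᵥ w) = w := by
    rw [Matrix.mulVec_mulVec, Matrix.nonsing_inv_mul _ (isUnit_det_eigFloor hV.1 hρ),
      Matrix.one_mulVec]
  have hdec : (eigFloor V ρ)⁻¹ *ᵥ (V *ᵥ w + S) - w
      = (eigFloor V ρ)⁻¹ *ᵥ S + (eigFloor V ρ)⁻¹ *ᵥ ((V - eigFloor V ρ) *ᵥ w) := by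
    rw [Matrix.mulVec_add, Matrix.sub_mulVec, Matrix.mulVec_sub, hw]
    abel
  rw [hdec, Matrix.mulVec_add]
  refine (eNorm_add_le _ _).trans (add_le_add le_rfl ?_)
  split_ifs with h
  · rw [mul_one]
    exact eNorm_matSqrt_mulVec_bias_le hV hρ w
  · have hsub : V - eigFloor V ρ = 0 := by
      rw [eigFloor_eq_self hV.1 (not_lt.1 h), sub_self]
    rw [hsub, Matrix.zero_mulVec, Matrix.mulVec_zero, Matrix.mulVec_zero, mul_zero]
    simp [eNorm]

end Spectrum

end VARModel

namespace VARModel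

/-! ### Covering numbers of the sphere -/

section Covering

variable {ι : Type*} [Fintype ι]

/-- Compactness of the sphere. Finiteness keeps `toNat` from collapsing an infinite covering number
to 0. -/
theorem coveringNumber_sphere_ne_top {r : ℝ} (hr : 0 < r) :
    Metric.coveringNumber r.toNNReal (Metric.sphere (0 : EuclideanSpace ℝ ι) 1) ≠ ⊤ := by
  obtain ⟨N, hN, hfin, hcov⟩ := Metric.exists_finite_isCover_of_isCompact
    (ε := r.toNNReal) (by simpa using hr) (isCompact_sphere (0 : EuclideanSpace ℝ ι) 1)
  exact ((hcov.coveringNumber_le_encard hN).trans_lt hfin.encard_lt_top).ne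

theorem exists_sphere_cover {r : ℝ} (hr : 0 < r) :
    ∃ K : Finset (EuclideanSpace ℝ ι), (∀ ν ∈ K, ‖ν‖ = 1) ∧ K.card = sphereCoveringNumber ι r ∧
      ∀ u : EuclideanSpace ℝ ι, ‖u‖ = 1 → ∃ ν ∈ K, ‖ν - u‖ ≤ r := by
  obtain ⟨C, hC, hfin, hcov, hcard⟩ :=
    Metric.exists_set_encard_eq_coveringNumber (coveringNumber_sphere_ne_top (ι := ι) hr)
  refine ⟨hfin.toFinset, fun ν hν => ?_, ?_, fun u hu => ?_⟩
  · simpa using hC (hfin.mem_toFinset.1 hν)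
  · rw [sphereCoveringNumber, ← hcard, hfin.encard_eq_coe_toFinset_card]
    rfl
  · obtain ⟨ν, hν, h⟩ := hcov (show u ∈ Metric.sphere (0 : EuclideanSpace ℝ ι) 1 by simpa using hu)
    refine ⟨ν, hfin.mem_toFinset.2 hν, ?_⟩
    have h' : edist u ν ≤ (r.toNNReal : ℝ≥0∞) := h
    rw [edist_nndist, ENNReal.coe_le_coe, ← NNReal.coe_le_coe, coe_nndist,
      Real.coe_toNNReal _ hr.le, dist_comm, dist_eq_norm] at h'
    exact h'

/-- A nonempty index type makes the sphere nonempty, hence any cover too; this legitimizes dividing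
by the covering number and taking its logarithm. -/
theorem one_le_sphereCoveringNumber [Nonempty ι] {r : ℝ} (hr : 0 < r) :
    1 ≤ sphereCoveringNumber ι r := by
  classical
  obtain ⟨K, -, hcard, hK⟩ := exists_sphere_cover (ι := ι) hr
  obtain ⟨ν, hν, -⟩ := hK (EuclideanSpace.single (Classical.arbitrary ι) 1) (by simp)
  rw [← hcard]
  exact Finset.card_pos.2 ⟨ν, hν⟩

theorem sphereCoveringNumber_anti {r s : ℝ} (hr : 0 < r) (hrs : r ≤ s) :
    sphereCoveringNumber ι s ≤ sphereCoveringNumber ι r :=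
  ENat.toNat_le_toNat (Metric.coveringNumber_anti (Real.toNNReal_le_toNNReal hrs))
    (coveringNumber_sphere_ne_top hr)

end Covering

/-! ### From directions to vectors -/

section SelfNormalizedVector

variable {ι : Type*} [Fintype ι]

theorem norm_sq_eq_dotProduct (v : EuclideanSpace ℝ ι) : ‖v‖ ^ 2 = v.ofLp ⬝ᵥ v.ofLp :=
  eNorm_sq v.ofLp

/-- The level spent on each point of the `j`-th covering of the sphere. -/
noncomputable def coverLevel (ι : Type*) [Fintype ι] (β ε δ : ℝ) (j : ℕ) : ℝ :=
  δ * (1 - β⁻¹) * (β⁻¹ ^ j) / sphereCoveringNumber ι (ε / β ^ (j + 1))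

theorem coverLevel_pos [Nonempty ι] {β ε δ : ℝ} (hβ : 1 < β) (hε : 0 < ε) (hδ : 0 < δ) (j : ℕ) :
    0 < coverLevel ι β ε δ j := by
  have hβ0 : 0 < β := one_pos.trans hβ
  have h1 : 0 < 1 - β⁻¹ := sub_pos.2 (inv_lt_one_of_one_lt₀ hβ)
  have h2 : 1 ≤ sphereCoveringNumber ι (ε / β ^ (j + 1)) :=
    one_le_sphereCoveringNumber (by positivity)
  have h3 : (0 : ℝ) < sphereCoveringNumber ι (ε / β ^ (j + 1)) := by exact_mod_cast h2
  unfold coverLevel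
  positivity

theorem coverLevel_le_one [Nonempty ι] {β ε δ : ℝ} (hβ : 1 < β) (hε : 0 < ε)
    (hδ1 : δ ≤ 1) (j : ℕ) : coverLevel ι β ε δ j ≤ 1 := by
  have hβ0 : 0 < β := one_pos.trans hβ
  have h1 : 0 ≤ 1 - β⁻¹ := (sub_pos.2 (inv_lt_one_of_one_lt₀ hβ)).le
  have h2 : 1 ≤ sphereCoveringNumber ι (ε / β ^ (j + 1)) :=
    one_le_sphereCoveringNumber (by positivity)
  have h3 : (1 : ℝ) ≤ sphereCoveringNumber ι (ε / β ^ (j + 1)) := by exact_mod_cast h2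
  have h4 : β⁻¹ ^ j ≤ 1 := pow_le_one₀ (inv_pos.2 hβ0).le (inv_lt_one_of_one_lt₀ hβ).le
  have h5 : 1 - β⁻¹ ≤ 1 := sub_le_self _ (inv_pos.2 hβ0).le
  refine div_le_one_of_le₀ (le_trans ?_ h3) (by positivity)
  exact mul_le_one₀ (mul_le_one₀ hδ1 h1 h5) (by positivity) h4

/-- The union bound over each net cancels the covering number in its level, and a geometric series
normalized by 1 − β⁻¹ remains. -/
theorem tsum_card_mul_coverLevel [Nonempty ι] {β ε δ : ℝ} (hβ : 1 < β) (hε : 0 < ε) (hδ : 0 < δ) :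
    ∑' j, (sphereCoveringNumber ι (ε / β ^ (j + 1)) : ℝ≥0∞)
      * ENNReal.ofReal (coverLevel ι β ε δ j) = ENNReal.ofReal δ := by
  have hβ0 : 0 < β := one_pos.trans hβ
  have hi0 : 0 ≤ β⁻¹ := (inv_pos.2 hβ0).le
  have hi1 : β⁻¹ < 1 := inv_lt_one_of_one_lt₀ hβ
  have h1 : 0 < 1 - β⁻¹ := sub_pos.2 hi1
  have hterm : ∀ j, (sphereCoveringNumber ι (ε / β ^ (j + 1)) : ℝ≥0∞)
      * ENNReal.ofReal (coverLevel ι β ε δ j) = ENNReal.ofReal (δ * (1 - β⁻¹) * β⁻¹ ^ j) := by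
    intro j
    have h2 : 1 ≤ sphereCoveringNumber ι (ε / β ^ (j + 1)) :=
      one_le_sphereCoveringNumber (by positivity)
    have h3 : (0 : ℝ) < sphereCoveringNumber ι (ε / β ^ (j + 1)) := by exact_mod_cast h2
    rw [← ENNReal.ofReal_natCast, ← ENNReal.ofReal_mul (Nat.cast_nonneg _), coverLevel,
      mul_div_cancel₀ _ h3.ne']
  simp only [hterm]
  rw [← ENNReal.ofReal_tsum_of_nonneg (fun j => by positivity)
    ((summable_geometric_of_lt_one hi0 hi1).mul_left _), tsum_mul_left,
    tsum_geometric_of_lt_one hi0 hi1, mul_assoc, mul_inv_cancel₀ h1.ne', mul_one]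

variable [DecidableEq ι]

/-- The bound along each point of the covering that matches the condition number of `V ∨ ρ I`
implies the bound on the whole self-normalized vector. -/
theorem eNorm_matSqrt_mulVec_inv_le_of_cover [Nonempty ι] {V : Matrix ι ι ℝ} (hV : V.PosSemidef)
    {α β ρ ε δ : ℝ} (hα : 1 < α) (hβ : 1 < β) (hρ : 0 < ρ)
    (hε : ε ∈ Set.Ioo (0 : ℝ) 1) (hδ : δ ∈ Set.Ioo (0 : ℝ) 1)
    {h : ℕ → ℝ} (hh : ∀ k, 1 ≤ h k) (hmono : Monotone h)
    {K : ℕ → Finset (EuclideanSpace ℝ ι)} (hK1 : ∀ j, ∀ ν ∈ K j, ‖ν‖ = 1)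
    (hK : ∀ j, ∀ u : EuclideanSpace ℝ ι, ‖u‖ = 1 → ∃ ν ∈ K j, ‖ν - u‖ ≤ ε / β ^ (j + 1))
    (S : ι → ℝ)
    (hS : ∀ j, ∀ ν ∈ K j, ν.ofLp ⬝ᵥ S ≤
      √(2 * α * (Real.log (h ⌊Real.logb α (max (ν.ofLp ⬝ᵥ (V *ᵥ ν.ofLp)) ρ / ρ)⌋₊)
          + Real.log (coverLevel ι β ε δ j)⁻¹)) * √(max (ν.ofLp ⬝ᵥ (V *ᵥ ν.ofLp)) ρ)) :
    eNorm (matSqrt (eigFloor V ρ) *ᵥ ((eigFloor V ρ)⁻¹ *ᵥ S))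
      ≤ 1 / (1 - ε) * √(2 * α * Lfun α β ε δ ρ h V) := by
  have hα0 : 0 < α := one_pos.trans hα
  have hβ0 : 0 < β := one_pos.trans hβ
  have hε0 := hε.1
  have hε1 : 0 < 1 - ε := sub_pos.2 hε.2
  have hWS := eigFloor_mulVec_inv_mulVec hV.1 hρ S
  have hRR := matSqrt_mul_matSqrt_eigFloor hV.1 hρ
  have hRsymm : (matSqrt (eigFloor V ρ)).IsSymm := isSymm_cfc _ _
  have hRsq : ∀ v, eNorm (matSqrt (eigFloor V ρ) *ᵥ v) ^ 2 = v ⬝ᵥ (eigFloor V ρ *ᵥ v) := fun v => by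
    rw [eNorm_sq, dotProduct_self_mulVec_of_isSymm hRsymm, hRR]
  have hWherm := isHermitian_eigFloor V ρ
  have hmin : ρ ≤ gammaMin (eigFloor V ρ) := le_gammaMin_eigFloor hV.1
  have hminpos := hρ.trans_le hmin
  have hmm := gammaMin_le_gammaMax hWherm
  have hκ1 := one_le_condNumber_eigFloor hV.1 hρ
  have hκ : gammaMax (eigFloor V ρ) = condNumber (eigFloor V ρ) * gammaMin (eigFloor V ρ) :=
    (div_mul_cancel₀ _ hminpos.ne').symm
  have hup := dotProduct_mulVec_le_gammaMax hWherm
  have hlow := gammaMin_le_dotProduct_mulVec hWherm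
  have hVW := dotProduct_mulVec_le_eigFloor hV.1 ρ
  unfold Lfun
  set W := eigFloor V ρ
  set R := matSqrt W
  set z := W⁻¹ *ᵥ S
  set κ := condNumber W
  have hsκ : 1 ≤ √κ := Real.one_le_sqrt.2 hκ1
  have hsκ0 : 0 < √κ := one_pos.trans_le hsκ
  -- A zero vector has no direction to approximate, and the bound is then trivial.
  rcases eq_or_ne z 0 with hz | hz
  · rw [hz, Matrix.mulVec_zero]
    have : eNorm (0 : ι → ℝ) = 0 := by simp [eNorm]
    rw [this]
    positivity
  -- The net is matched to the condition number: β^(j+1) ≥ √κ makes it fine enough, while β^(j+1) ≤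
  -- β√κ bounds its cardinality by the covering number in L_ρ.
  set j := ⌊Real.logb β (√κ)⌋₊
  have hj1 : β ^ j ≤ √κ := by
    rw [← Real.rpow_natCast, ← Real.le_logb_iff_rpow_le hβ hsκ0]
    exact Nat.floor_le (Real.logb_nonneg hβ hsκ)
  have hj2 : √κ ≤ β ^ (j + 1) := by
    rw [← Real.rpow_natCast, ← Real.logb_le_iff_le_rpow hβ hsκ0]
    push_cast
    exact (Nat.lt_floor_add_one _).le
  have hj3 : β ^ (j + 1) ≤ β * √κ := by
    rw [pow_succ']
    exact mul_le_mul_of_nonneg_left hj1 hβ0.le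
  set c := eNorm z
  have hc0 : 0 ≤ c := eNorm_nonneg z
  have hc : c ≠ 0 := fun h0 => hz (by
    have h1 : (WithLp.toLp 2 z : EuclideanSpace ℝ ι) = 0 := norm_eq_zero.1 h0
    simpa using h1)
  have hu : eNorm (c⁻¹ • z) = 1 := by
    rw [eNorm_smul, abs_of_nonneg (inv_nonneg.2 hc0)]
    exact inv_mul_cancel₀ hc
  have hcz : c • c⁻¹ • z = z := smul_inv_smul₀ hc z
  obtain ⟨ν, hνK, hν⟩ := hK j (WithLp.toLp 2 (c⁻¹ • z)) hu
  have hν1 : ν.ofLp ⬝ᵥ ν.ofLp = 1 := by rw [← norm_sq_eq_dotProduct, hK1 j ν hνK, one_pow]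
  set x := max (ν.ofLp ⬝ᵥ (V *ᵥ ν.ofLp)) ρ
  -- The clock in direction ν lies below ‖W^{1/2}ν‖², because W dominates both V and ρI. This is the
  -- normalization that `eNorm_mulVec_le_of_near` expects.
  have hxW : x ≤ ν.ofLp ⬝ᵥ (W *ᵥ ν.ofLp) := by
    refine max_le (hVW _) (hmin.trans ?_)
    have := hlow ν.ofLp
    rwa [hν1, mul_one] at this
  have hxmax : x ≤ gammaMax W := by
    have := hup ν.ofLp
    rw [hν1, mul_one] at this
    exact hxW.trans this
  have hxρ : 1 ≤ x / ρ := (one_le_div hρ).2 (le_max_right _ _)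
  have hlogh : Real.log (h ⌊Real.logb α (x / ρ)⌋₊)
      ≤ Real.log (h ⌊Real.logb α (gammaMax W / ρ)⌋₊) := by
    refine Real.log_le_log (one_pos.trans_le (hh _)) (hmono (Nat.floor_le_floor ?_))
    refine Real.logb_le_logb_of_le hα (one_pos.trans_le hxρ) ?_
    gcongr
  have hr0 : 0 < ε / (β * √κ) := by positivity
  have hNle : sphereCoveringNumber ι (ε / β ^ (j + 1)) ≤ sphereCoveringNumber ι (ε / (β * √κ)) :=
    sphereCoveringNumber_anti hr0 (by gcongr)
  have hN1 : 1 ≤ sphereCoveringNumber ι (ε / β ^ (j + 1)) :=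
    one_le_sphereCoveringNumber (by positivity)
  have hN1' : (0 : ℝ) < sphereCoveringNumber ι (ε / β ^ (j + 1)) := by exact_mod_cast hN1
  have hNle' : (sphereCoveringNumber ι (ε / β ^ (j + 1)) : ℝ)
      ≤ sphereCoveringNumber ι (ε / (β * √κ)) := by exact_mod_cast hNle
  have hlogq : Real.log (coverLevel ι β ε δ j)⁻¹ ≤ Real.log (1 / δ * (1 / (1 - β⁻¹)))
      + Real.log (β * √κ * (sphereCoveringNumber ι (ε / (β * √κ)) : ℝ)) := by
    have h1 : 0 < 1 - β⁻¹ := sub_pos.2 (inv_lt_one_of_one_lt₀ hβ)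
    have hδ0 := hδ.1
    have hfac : (coverLevel ι β ε δ j)⁻¹ = (1 / δ * (1 / (1 - β⁻¹)))
        * (β ^ j * (sphereCoveringNumber ι (ε / β ^ (j + 1)) : ℝ)) := by
      rw [coverLevel, inv_div, inv_pow]
      have := h1.ne'
      generalize 1 - β⁻¹ = b at this
      field_simp
    rw [hfac, Real.log_mul (by positivity) (by positivity)]
    refine add_le_add le_rfl (Real.log_le_log (by positivity) ?_)
    -- A factor β is given away here, since β^j ≤ √κ already holds.
    have hpow : β ^ j ≤ β * √κ := (pow_le_pow_right₀ hβ.le (Nat.le_succ j)).trans hj3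
    gcongr
  have hB := hS j ν hνK
  have hbound := eNorm_mulVec_le_of_near hRsymm (a := gammaMin W) (b := gammaMax W)
    (r := ε / β ^ (j + 1)) (ε := ε) (c := c) (u := c⁻¹ • z) (ν := ν.ofLp)
    (B := √(2 * α * (Real.log (h ⌊Real.logb α (gammaMax W / ρ)⌋₊)
      + Real.log (1 / δ * (1 / (1 - β⁻¹)))
      + Real.log (β * √κ * (sphereCoveringNumber ι (ε / (β * √κ)) : ℝ)))))
    hminpos (fun v => by rw [hRR]; exact hlow v) (fun v => by rw [hRR]; exact hup v)
    (hminpos.le.trans hmm) hε0.le hε.2.le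
    (by
      rw [hκ, div_pow, div_mul_eq_mul_div, div_le_iff₀ (by positivity)]
      have h1 : κ ≤ (β ^ (j + 1)) ^ 2 := by
        rw [← Real.sq_sqrt (zero_le_one.trans hκ1)]
        gcongr
      calc ε ^ 2 * (κ * gammaMin W) = (ε ^ 2 * gammaMin W) * κ := by ring
        _ ≤ _ := mul_le_mul_of_nonneg_left h1 (by positivity))
    (by rw [← eNorm_sq, hu, one_pow]) hν1
    (by
      have h1 := norm_sq_eq_dotProduct (ν - WithLp.toLp 2 (c⁻¹ • z))
      rw [WithLp.ofLp_sub] at h1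
      rw [← h1]
      gcongr)
    hc0
    (by
      rw [hcz, hRR, hWS]
      refine hB.trans (mul_le_mul (Real.sqrt_le_sqrt ?_) ?_ (Real.sqrt_nonneg _)
        (Real.sqrt_nonneg _))
      · refine mul_le_mul_of_nonneg_left ?_ (by positivity)
        linarith
      · rw [← Real.sqrt_sq (eNorm_nonneg (R *ᵥ ν.ofLp)), hRsq]
        exact Real.sqrt_le_sqrt hxW)
  rw [hcz] at hbound
  rw [one_div, inv_mul_eq_div, le_div_iff₀ hε1, mul_comm]
  exact hbound

variable {Ω : Type*} {m0 : MeasurableSpace Ω} {μ : Measure Ω} [IsProbabilityMeasure μ]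
  {F : ℕ → MeasurableSpace Ω}

/-- Time-uniform self-normalized bound for a vector-valued sum `∑ e_s X_s` with predictable `X` and
conditionally sub-Gaussian `e`. -/
theorem measure_compl_forall_eNorm_le [Nonempty ι] (hF : ∀ t, F t ≤ m0) (hFmono : Monotone F)
    {X : ℕ → Ω → ι → ℝ} {e : ℕ → Ω → ℝ}
    (hX : ∀ t k, Measurable[F t] fun ω => X t ω k) (he : ∀ t, Measurable[F (t + 1)] (e t))
    (hint : ∀ t, ∀ l : ℝ, Integrable (fun ω => Real.exp (l * e t ω)) μ)
    (hsub : ∀ t, ∀ l : ℝ,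
      ∀ᵐ ω ∂μ, Real.log ((μ[fun ω' => Real.exp (l * e t ω') | F t]) ω) ≤ l ^ 2 / 2)
    {V : ℕ → Ω → Matrix ι ι ℝ} (hV : ∀ t ω, (V t ω).PosSemidef)
    (hVX : ∀ t ω v, v ⬝ᵥ (V t ω *ᵥ v) = ∑ s ∈ Finset.range t, (v ⬝ᵥ X s ω) ^ 2)
    {α β ρ ε δ : ℝ} (hα : 1 < α) (hβ : 1 < β) (hρ : 0 < ρ)
    (hε : ε ∈ Set.Ioo (0 : ℝ) 1) (hδ : δ ∈ Set.Ioo (0 : ℝ) 1)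
    {h : ℕ → ℝ} (hh : ∀ k, 1 ≤ h k) (hmono : Monotone h)
    (hsum : Summable fun k => (h k)⁻¹) (hle : ∑' k, (h k)⁻¹ ≤ 1) :
    μ {ω | ∀ t, eNorm (matSqrt (eigFloor (V t ω) ρ) *ᵥ
        ((eigFloor (V t ω) ρ)⁻¹ *ᵥ ∑ s ∈ Finset.range t, e s ω • X s ω))
          ≤ 1 / (1 - ε) * √(2 * α * Lfun α β ε δ ρ h (V t ω))}ᶜ ≤ ENNReal.ofReal δ := by
  have hβ0 : 0 < β := one_pos.trans hβ
  have hr : ∀ j : ℕ, 0 < ε / β ^ (j + 1) := fun j => div_pos hε.1 (by positivity)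
  choose K hK1 hKcard hK using fun j => exists_sphere_cover (ι := ι) (hr j)
  let bad : ℕ → EuclideanSpace ℝ ι → Set Ω := fun j ν =>
    {ω | ∃ t, √(2 * α * (Real.log (h ⌊Real.logb α
          (max (∑ s ∈ Finset.range t, (ν.ofLp ⬝ᵥ X s ω) ^ 2) ρ / ρ)⌋₊)
            + Real.log (coverLevel ι β ε δ j)⁻¹))
        * √(max (∑ s ∈ Finset.range t, (ν.ofLp ⬝ᵥ X s ω) ^ 2) ρ)
          < ∑ s ∈ Finset.range t, ν.ofLp ⬝ᵥ X s ω * e s ω}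
  have hbad : ∀ j ν, μ (bad j ν) ≤ ENNReal.ofReal (coverLevel ι β ε δ j) := by
    intro j ν
    refine measure_exists_stitched_lt_le (x := fun s ω => ν.ofLp ⬝ᵥ X s ω) hF hFmono
      (fun t => ?_) he hint hsub hα hρ (coverLevel_pos hβ hε.1 hδ.1 j)
      (coverLevel_le_one hβ hε.1 hδ.2.le j) hh hsum hle
    exact Finset.measurable_fun_sum _ fun k _ => (hX t k).const_mul _
  calc μ {ω | ∀ t, eNorm (matSqrt (eigFloor (V t ω) ρ) *ᵥ
        ((eigFloor (V t ω) ρ)⁻¹ *ᵥ ∑ s ∈ Finset.range t, e s ω • X s ω))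
          ≤ 1 / (1 - ε) * √(2 * α * Lfun α β ε δ ρ h (V t ω))}ᶜ
      ≤ μ (⋃ j, ⋃ ν ∈ K j, bad j ν) := by
        -- Outside every bad event the directional bounds hold at each `t`, and the rest is
        -- deterministic. Only monotonicity of the outer measure is used, so the event need not be
        -- measurable.
        refine measure_mono (Set.compl_subset_comm.1 fun ω hω t => ?_)
        refine eNorm_matSqrt_mulVec_inv_le_of_cover (hV t ω) hα hβ hρ hε hδ hh hmono hK1 hK _
          fun j ν hν => ?_
        have hnot : ω ∉ bad j ν := fun hb => hω (Set.mem_iUnion.2 ⟨j, Set.mem_iUnion₂.2 ⟨ν, hν, hb⟩⟩)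
        rw [hVX, dotProduct_sum]
        simp only [dotProduct_smul, smul_eq_mul, mul_comm (e _ ω)]
        exact not_lt.1 fun hlt => hnot ⟨t, hlt⟩
    _ ≤ ∑' j, ∑ ν ∈ K j, μ (bad j ν) :=
        (measure_iUnion_le _).trans
          (ENNReal.tsum_le_tsum fun j => measure_biUnion_finset_le (K j) (bad j))
    _ ≤ ∑' j, (sphereCoveringNumber ι (ε / β ^ (j + 1)) : ℝ≥0∞)
          * ENNReal.ofReal (coverLevel ι β ε δ j) := by
        refine ENNReal.tsum_le_tsum fun j => (Finset.sum_le_card_nsmul _ _ _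
          fun ν _ => hbad j ν).trans_eq ?_
        rw [hKcard, nsmul_eq_mul]
    _ = ENNReal.ofReal δ := tsum_card_mul_coverLevel hβ hε.1 hδ.1

end SelfNormalizedVector

end VARModel

namespace VARModel

/-! ### The autoregressive model as a predictable regression -/

section Autoregression

variable {Ω : Type*} {p d : ℕ} {Y : ℤ → Ω → EuclideanSpace ℝ (Fin d)}

/-- The regressor `X_{s+1}`. -/
def regressor (p : ℕ) (Y : ℤ → Ω → EuclideanSpace ℝ (Fin d)) (s : ℕ) (ω : Ω) :
    Fin p × Fin d → ℝ :=
  fun q => Y (((s : ℤ) + 1) - ((q.1 : ℤ) + 1)) ω q.2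

theorem posSemidef_covProc (t : ℕ) (ω : Ω) : (covProc p Y t ω).PosSemidef := by
  have h := Matrix.posSemidef_conjTranspose_mul_self (design p Y t ω)
  rwa [Matrix.conjTranspose_eq_transpose_of_trivial] at h

theorem dotProduct_covProc_mulVec (t : ℕ) (ω : Ω) (v : Fin p × Fin d → ℝ) :
    v ⬝ᵥ (covProc p Y t ω *ᵥ v) = ∑ s ∈ Finset.range t, (v ⬝ᵥ regressor p Y s ω) ^ 2 := by
  rw [covProc, ← Matrix.mulVec_mulVec, Matrix.dotProduct_mulVec, Matrix.vecMul_transpose,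
    dotProduct, Finset.sum_range]
  refine Finset.sum_congr rfl fun s _ => ?_
  rw [sq, dotProduct_comm v]
  rfl

theorem past_mono (p : ℕ) (Y : ℤ → Ω → EuclideanSpace ℝ (Fin d)) :
    Monotone fun t : ℕ => past p Y t := fun s t hst =>
  biSup_mono fun u hu => ⟨hu.1, hu.2.trans (by exact_mod_cast hst)⟩

theorem measurable_past {s t : ℤ} (hs : -(p : ℤ) + 1 ≤ s) (hst : s ≤ t) :
    Measurable[past p Y t] (Y s) :=
  (comap_measurable (Y s)).mono
    (le_iSup₂ (f := fun (u : ℤ) (_ : u ∈ Set.Icc (-(p : ℤ) + 1) t) =>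
      MeasurableSpace.comap (Y u) inferInstance) s ⟨hs, hst⟩) le_rfl

theorem measurable_past_apply {s t : ℤ} (hs : -(p : ℤ) + 1 ≤ s) (hst : s ≤ t) (k : Fin d) :
    Measurable[past p Y t] fun ω => Y s ω k :=
  (EuclideanSpace.proj k : EuclideanSpace ℝ (Fin d) →L[ℝ] ℝ).measurable.comp
    (measurable_past hs hst)

/-- Predictability: the entries of X_{s+1} are taken from Y_s, …, Y_{s-p+1}, and the oldest index is
−p + 1 at s = 0, exactly where the filtration starts. -/
theorem measurable_regressor (s : ℕ) (q : Fin p × Fin d) :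
    Measurable[past p Y s] fun ω => regressor p Y s ω q := by
  have := q.1.2
  exact measurable_past_apply (by omega) (by omega) q.2

section Measurability

variable [MeasurableSpace Ω] {μ : Measure Ω}
  {ξ : ℕ → Ω → EuclideanSpace ℝ (Fin d)} {A : Fin p → Matrix (Fin d) (Fin d) ℝ}

theorem IsVAR.past_le (hY : IsVAR μ A Y ξ) (t : ℤ) : past p Y t ≤ ‹MeasurableSpace Ω› :=
  iSup₂_le fun s hs => (hY.measurable s hs.1).comap_le

/-- Solving the recursion for the noise exhibits it as a function of the process, so its adaptedness
need not be assumed. -/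
theorem IsVAR.noise_apply (hY : IsVAR μ A Y ξ) (s : ℕ) (ω : Ω) (i : Fin d) :
    ξ (s + 1) ω i = Y ((s : ℤ) + 1) ω i - regressor p Y s ω ⬝ᵥ stackedRow A i := by
  have h := congrArg (fun v : EuclideanSpace ℝ (Fin d) => v i)
    (hY.recursion (s + 1) (Nat.succ_le_succ (Nat.zero_le s)) ω)
  simp only [Nat.cast_add, Nat.cast_one, PiLp.add_apply, WithLp.ofLp_sum, Finset.sum_apply,
    Matrix.toEuclideanLin, Matrix.ofLp_toLpLin, Matrix.toLin'_apply, Matrix.mulVec, dotProduct] at h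
  rw [h, dotProduct, Fintype.sum_prod_type]
  simp only [regressor, stackedRow, mul_comm (A _ _ _), add_sub_cancel_left]

theorem IsVAR.measurable_noise_apply (hY : IsVAR μ A Y ξ) (s : ℕ) (i : Fin d) :
    Measurable[past p Y ((s + 1 : ℕ) : ℤ)] fun ω => ξ (s + 1) ω i := by
  simp only [hY.noise_apply]
  refine Measurable.sub (measurable_past_apply (by omega) (by push_cast; exact le_rfl) i) ?_
  exact Finset.measurable_fun_sum _ fun q _ =>
    ((measurable_regressor s q).mono (past_mono p Y (Nat.le_succ s)) le_rfl).mul_const _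

/-- The model controls l ≥ 0 only, whereas predictable coefficients take both signs; a negative sign
is absorbed by reversing the unit vector. -/
theorem exists_norm_eq_one_mul_inner_eq (i : Fin d) (l : ℝ) :
    ∃ ν : EuclideanSpace ℝ (Fin d), ‖ν‖ = 1 ∧
      ∀ x : EuclideanSpace ℝ (Fin d), |l| * inner ℝ ν x = l * x i := by
  rcases le_total 0 l with h | h
  · refine ⟨EuclideanSpace.single i 1, by simp, fun x => ?_⟩
    rw [abs_of_nonneg h, EuclideanSpace.inner_single_left, map_one, one_mul]
  · refine ⟨-EuclideanSpace.single i 1, by simp, fun x => ?_⟩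
    rw [abs_of_nonpos h, inner_neg_left, EuclideanSpace.inner_single_left, map_one, one_mul,
      neg_mul_neg]

theorem IsVAR.integrable_exp_noise_apply (hY : IsVAR μ A Y ξ) (s : ℕ) (i : Fin d) (l : ℝ) :
    Integrable (fun ω => Real.exp (l * ξ (s + 1) ω i)) μ := by
  obtain ⟨ν, hν, h⟩ := exists_norm_eq_one_mul_inner_eq i l
  simpa only [h] using hY.integrable (s + 1) (Nat.succ_le_succ (Nat.zero_le s)) ν hν |l| (abs_nonneg l)

theorem IsVAR.log_condExp_noise_apply_le (hY : IsVAR μ A Y ξ) (s : ℕ) (i : Fin d) (l : ℝ) :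
    ∀ᵐ ω ∂μ, Real.log ((μ[fun ω' => Real.exp (l * ξ (s + 1) ω' i) | past p Y (s : ℤ)]) ω)
      ≤ l ^ 2 / 2 := by
  obtain ⟨ν, hν, h⟩ := exists_norm_eq_one_mul_inner_eq i l
  have := hY.subGaussian (s + 1) (Nat.succ_le_succ (Nat.zero_le s)) ν hν |l| (abs_nonneg l)
  simpa only [h, sq_abs, Nat.cast_add, Nat.cast_one, add_sub_cancel_right] using this

/-- The normal equations, which isolate the self-normalized sum. -/
theorem IsVAR.transpose_design_mulVec_response (hY : IsVAR μ A Y ξ) (t : ℕ) (ω : Ω) (i : Fin d) :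
    (design p Y t ω)ᵀ *ᵥ response Y t ω i = covProc p Y t ω *ᵥ stackedRow A i
      + ∑ s ∈ Finset.range t, ξ (s + 1) ω i • regressor p Y s ω := by
  have hresp : response Y t ω i
      = design p Y t ω *ᵥ stackedRow A i + fun s : Fin t => ξ (s + 1) ω i := by
    ext s
    rw [Pi.add_apply, hY.noise_apply]
    exact (add_sub_cancel _ _).symm
  rw [hresp, Matrix.mulVec_add, Matrix.mulVec_mulVec, covProc, Finset.sum_range]
  congr 1
  ext q
  simp only [Matrix.mulVec, dotProduct, Finset.sum_apply, Pi.smul_apply, smul_eq_mul]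
  exact Finset.sum_congr rfl fun s _ => mul_comm _ _

end Measurability

end Autoregression

end VARModel


/-! ### The least-squares bound -/

theorem corollary5p3 {Ω : Type*} [MeasurableSpace Ω] (μ : Measure Ω) [IsProbabilityMeasure μ]
    {p d : ℕ} (hp : 1 ≤ p)
    (A : Fin p → Matrix (Fin d) (Fin d) ℝ)
    (Y : ℤ → Ω → EuclideanSpace ℝ (Fin d)) (ξ : ℕ → Ω → EuclideanSpace ℝ (Fin d))
    (hY : VARModel.IsVAR μ A Y ξ)
    (i : Fin d)
    (α β ρ ε δ : ℝ) (hα : 1 < α) (hβ : 1 < β) (hρ : 0 < ρ)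
    (hε : ε ∈ Set.Ioo (0 : ℝ) 1) (hδ : δ ∈ Set.Ioo (0 : ℝ) 1)
    (h : ℕ → ℝ) (hpos : ∀ k, 0 < h k) (hmono : Monotone h)
    (hsum : Summable fun k => (h k)⁻¹) (hle : ∑' k, (h k)⁻¹ ≤ 1) :
    -- the event on which the bounds hold for all `t ≥ 1` has probability at least `1 - δ`
    μ {ω | ∀ t : ℕ, 1 ≤ t →
        VARModel.eNorm (VARModel.matSqrt (VARModel.eigFloor (VARModel.covProc p Y t ω) ρ) *ᵥ
            (VARModel.lsEstimate p ρ Y t ω i - VARModel.stackedRow A i))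
          ≤ 1 / (1 - ε) * √(2 * α * VARModel.Lfun α β ε δ ρ h (VARModel.covProc p Y t ω))
            + √ρ * VARModel.eNorm (VARModel.stackedRow A i)
              * (if VARModel.gammaMin (VARModel.covProc p Y t ω) < ρ then 1 else 0)
        ∧ (ρ ≤ VARModel.gammaMin (VARModel.covProc p Y t ω) →
          VARModel.eNorm (VARModel.matSqrt (VARModel.eigFloor (VARModel.covProc p Y t ω) ρ) *ᵥ
              (VARModel.olsEstimate p Y t ω i - VARModel.stackedRow A i))
            ≤ 1 / (1 - ε) * √(2 * α * VARModel.Lfun α β ε δ ρ h (VARModel.covProc p Y t ω)))}ᶜ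
      ≤ ENNReal.ofReal δ := by
  have : Nonempty (Fin p × Fin d) := ⟨(⟨0, hp⟩, i)⟩
  -- Each term of a positive series with sum at most 1 is at most 1; this makes the logarithms of
  -- `h` nonnegative.
  have hh : ∀ k, 1 ≤ h k := fun k =>
    (inv_le_one₀ (hpos k)).1 ((hsum.le_tsum k fun j _ => (inv_pos.2 (hpos j)).le).trans hle)
  refine (measure_mono (Set.compl_subset_compl.2 fun ω hω => ?_)).trans
    -- Times are shifted by one: at index s the regressor is X_{s+1}, known at time s, and the noise
    -- is ξ_{s+1}, known at time s + 1.
    (VARModel.measure_compl_forall_eNorm_le (μ := μ) (F := fun t : ℕ => VARModel.past p Y t)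
      (fun t => hY.past_le t) (VARModel.past_mono p Y) (X := VARModel.regressor p Y)
      (e := fun s ω => ξ (s + 1) ω i) VARModel.measurable_regressor
      (fun s => hY.measurable_noise_apply s i) (fun s => hY.integrable_exp_noise_apply s i)
      (fun s => hY.log_condExp_noise_apply_le s i) VARModel.posSemidef_covProc
      VARModel.dotProduct_covProc_mulVec hα hβ hρ hε hδ hh hmono hsum hle)
  intro t _
  have hV := VARModel.posSemidef_covProc (p := p) (Y := Y) t ω
  have key : VARModel.eNorm (VARModel.matSqrt (VARModel.eigFloor (VARModel.covProc p Y t ω) ρ) *ᵥ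
      (VARModel.lsEstimate p ρ Y t ω i - VARModel.stackedRow A i))
        ≤ 1 / (1 - ε) * √(2 * α * VARModel.Lfun α β ε δ ρ h (VARModel.covProc p Y t ω))
          + √ρ * VARModel.eNorm (VARModel.stackedRow A i)
            * (if VARModel.gammaMin (VARModel.covProc p Y t ω) < ρ then 1 else 0) := by
    rw [VARModel.lsEstimate, hY.transpose_design_mulVec_response]
    exact (VARModel.eNorm_matSqrt_mulVec_error_le hV hρ _ _).trans (add_le_add (hω t) le_rfl)
  refine ⟨key, fun hmin => ?_⟩
  have hols : VARModel.olsEstimate p Y t ω i = VARModel.lsEstimate p ρ Y t ω i := by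
    rw [VARModel.olsEstimate, VARModel.lsEstimate, VARModel.eigFloor_eq_self hV.1 hmin]
  rw [if_neg (not_lt.2 hmin), mul_zero, add_zero] at key
  rw [hols]
  exact key
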